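/- Let $\mathcal X$ be a measurable space and let $k\colon\mathcal X\times\mathcal X\to\mathbb R$ be a symmetric, positive (semi)definite kernel that is bounded and jointly measurable (for example, bounded and continuous on a second countable space with its Borel $\sigma$-algebra), with reproducing kernel Hilbert space $(\mathcal H_k,\|\cdot\|_k)$. Let $\rho$ be a probability measure on $\mathcal X\times\mathbb R$ with $\int f^2\,\rho(dx,df)<\infty$, let $P=\rho(\cdot\times\mathbb R)$ be its first marginal, and put $$Kw(x)=\int_{\mathcal X}k(x,y)\,w(y)\,P(dy),\qquad \|g\|_2^2=\int_{\mathcal X} g^2\,dP .$$ For $(X,f)\sim\rho$ let $f_0\in\mathcal H_k$ be (a version of) the regression function $f_0(x)=\mathbb E(f\mid X=x)$, i.e. $f_0(X)=\mathbb E(f\mid X)$ almost surely. For $n\ge1$, independent observations $(X_1,f_1),\dots,(X_n,f_n)$ with law $\rho$, and $\lambda_n>0$, let $$\hat f_n(\cdot)=\frac1n\sum_{i=1}^n k(\cdot,X_i)\,\hat w_i,\qquad \text{where}\quad \lambda_n\hat w_i+\frac1n\sum_{j=1}^n k(X_i,X_j)\,\hat w_j=f_i,\quad i=1,\dots,n .$$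 (i) Suppose that $f_0$ is in the range of $K\colon\mathcal H_k\to\mathcal H_k$, i.e. $f_0=Kw_0$ (at every point of $\mathcal X$) for some $w_0\in\mathcal H_k$, and that $\lambda_n=C\,n^{-1/5}$ with a constant $C>0$. Then $\|f_0-\hat f_n\|_k^2$ is integrable and there is a constant $B$, depending only on $k$, $\rho$ and $C$, such that for all $n\ge1$ $$\mathbb E\,\|f_0-\hat f_n\|_k^2\le B\,n^{-2/5}.$$ (ii) Suppose that $f_0=Kw_0$ (at every point of $\mathcal X$) for some $w_0\in L^2(P)$ (in particular this holds in the situation of (i)), and that $(\lambda_n)_{n\ge1}$ is a sequence of positive numbers of exact order $n^{-1/5}$, i.e. $c\,n^{-1/5}\le\lambda_n\le c'\,n^{-1/5}$ for all large $n$ with constants $0<c\le c'$. Then $\|f_0-\hat f_n\|_2^2$ is integrable and there is a constant $B$, depending only on $k$, $\rho$ and the sequence $(\lambda_n)$, such that for all $n\ge1$ $$\mathbb E\,\|f_0-\hat f_n\|_2^2\le B\,n^{-2/5}.$$ -/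

import Mathlib

open MeasureTheory ProbabilityTheory Filter Asymptotics

noncomputable section

/-- The integral operator `(K w)(x) = ∫ k(x, y) w(y) P(dy)` of the kernel `k` with respect to the
measure `P`. -/
def kernelOp {X : Type*} [MeasurableSpace X] (k : X → X → ℝ) (P : Measure X) (w : X → ℝ) :
    X → ℝ :=
  fun x => ∫ y, k x y * w y ∂P

/-- `f₀` is the regression function `f₀(x) = E(f | X = x)` of a pair `(X, f)` with joint law `ρ`,
that is, `E(f | X) = f₀(X)` almost surely. -/
def IsRegressionFunction {X : Type*} [MeasurableSpace X] (ρ : Measure (X × ℝ)) (f₀ : X → ℝ) :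
    Prop :=
  (fun z : X × ℝ => f₀ z.1) =ᵐ[ρ]
    ρ[(fun z : X × ℝ => z.2) | MeasurableSpace.comap (Prod.fst : X × ℝ → X) inferInstance]

/-- `Z 0, …, Z (n - 1)` are independent random observations `(X_i, f_i)` with common law `ρ`. -/
structure IsIIDSample {X Ω : Type*} [MeasurableSpace X] [MeasurableSpace Ω] {n : ℕ}
    (ρ : Measure (X × ℝ)) (μ : Measure Ω) (Z : Fin n → Ω → X × ℝ) : Prop where
  hasLaw : ∀ i, HasLaw (Z i) ρ μ
  indep : iIndepFun Z μ

/-- The Gram matrix `(k(x_i, x_j))_{i j}` of the design points of the observations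
`z_i = (x_i, f_i)`. -/
def gramMatrix {X : Type*} (k : X → X → ℝ) {n : ℕ} (z : Fin n → X × ℝ) :
    Matrix (Fin n) (Fin n) ℝ :=
  Matrix.of fun i j => k (z i).1 (z j).1

/-- The weights `ŵ = (l + K / n)⁻¹ f` of the estimator with regularization parameter `l`, where
`K` is the Gram matrix and `f = (f_1, …, f_n)`. -/
def krrWeights {X : Type*} (k : X → X → ℝ) (l : ℝ) {n : ℕ} (z : Fin n → X × ℝ) : Fin n → ℝ :=
  (l • (1 : Matrix (Fin n) (Fin n) ℝ) + (n : ℝ)⁻¹ • gramMatrix k z)⁻¹.mulVec fun i => (z i).2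

/-- The estimator `f̂(·) = (1 / n) ∑ i, ŵ_i k(·, x_i)`, as an element of the reproducing kernel
Hilbert space `H` with kernel `k`. The element `RKHS.kerFun H x 1` of `H` is the function
`k(·, x)`. -/
def krrEstimator {X : Type*} (H : Type*) [NormedAddCommGroup H] [InnerProductSpace ℝ H]
    [CompleteSpace H] [RKHS ℝ H X ℝ] (k : X → X → ℝ) (l : ℝ) {n : ℕ} (z : Fin n → X × ℝ) : H :=
  (n : ℝ)⁻¹ • ∑ i, krrWeights k l z i • RKHS.kerFun H (z i).1 (1 : ℝ)

end

/-! ### Reproducing property, measurability, and the inclusion of `H` in `L²(P)` -/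

section RKHSFacts

variable {X : Type*} {H : Type*} [NormedAddCommGroup H] [InnerProductSpace ℝ H]
  [CompleteSpace H] [RKHS ℝ H X ℝ]

/-! Let `S : H → L²(P)` be the inclusion, so that `S*` acts as `K` and the source conditions read
`f₀ = S*S w₀` in (i) and `f₀ = S* w₀` in (ii). With `g = l (l + S*S)⁻¹ f₀`, the population
regularized solution is `f₀ - g`, and the error splits into the bias `g` and the deviation of the
estimator from `f₀ - g`.

Bias: testing the equation for `g` against suitable vectors gives `‖g‖ ≤ l ‖w₀‖` in (i)
(`norm_tikhonov_bias_le_of_source`) and `‖S g‖ ≤ l ‖w₀‖` in (ii) (`norm_map_tikhonov_bias_le`).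

Deviation: the empirical normal operator is at least `l`, so the deviation is at most `l⁻¹` times
the residual of the empirical normal equation at `f₀ - g` (`norm_krrEstimator_sub_le`). This
residual is a centred mean of `n` independent vectors, precisely because `S*S g = l (f₀ - g)`, so
its mean square is at most `V / n` with `V` independent of `l` (`integral_norm_sq_krr_residual_le`).

The risk is thus of order `l² + 1 / (l² n)`. For `l` of order `n^(-1/5)` the first term is
`n^(-2/5)` and the second only `n^(-3/5)`.

`H` need not be separable, so random elements of `H` are handled through real-valued inner products
only. -/

theorem inner_kerFun_one (h : H) (x : X) : inner ℝ (RKHS.kerFun H x (1 : ℝ)) h = h x := by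
  simp

theorem inner_kerFun_kerFun {k : X → X → ℝ} (hk : ∀ x y, RKHS.kernel H x y (1 : ℝ) = k x y)
    (x y : X) :
    inner ℝ (RKHS.kerFun H x (1 : ℝ)) (RKHS.kerFun H y (1 : ℝ)) = k x y := by
  rw [inner_kerFun_one, RKHS.kerFun_apply, hk]

theorem norm_kerFun_one_sq_le {k : X → X → ℝ} (hk : ∀ x y, RKHS.kernel H x y (1 : ℝ) = k x y)
    {M : ℝ} (hM : ∀ x y, |k x y| ≤ M) (x : X) :
    ‖RKHS.kerFun H x (1 : ℝ)‖ ^ 2 ≤ M := by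
  rw [← real_inner_self_eq_norm_sq, inner_kerFun_kerFun hk]
  exact (le_abs_self _).trans (hM x x)

theorem sq_apply_le {k : X → X → ℝ} (hk : ∀ x y, RKHS.kernel H x y (1 : ℝ) = k x y)
    {M : ℝ} (hM : ∀ x y, |k x y| ≤ M) (h : H) (x : X) : (h x) ^ 2 ≤ M * ‖h‖ ^ 2 := by
  have h1 := abs_real_inner_le_norm (RKHS.kerFun H x (1 : ℝ)) h
  rw [inner_kerFun_one] at h1
  calc (h x) ^ 2 = |h x| ^ 2 := (sq_abs _).symm
    _ ≤ (‖RKHS.kerFun H x (1 : ℝ)‖ * ‖h‖) ^ 2 := by gcongr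
    _ = ‖RKHS.kerFun H x (1 : ℝ)‖ ^ 2 * ‖h‖ ^ 2 := by ring
    _ ≤ M * ‖h‖ ^ 2 := by gcongr; exact norm_kerFun_one_sq_le hk hM x

variable [MeasurableSpace X]

/-- The elements of a reproducing kernel Hilbert space with measurable kernel are measurable. -/
theorem measurable_rkhs {k : X → X → ℝ} (hk_meas : Measurable (Function.uncurry k))
    (hk : ∀ x y, RKHS.kernel H x y (1 : ℝ) = k x y) (h : H) : Measurable h := by
  have hspan : ∀ g ∈ Submodule.span ℝ {RKHS.kerFun H x v | (x : X) (v : ℝ)},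
      Measurable (g : X → ℝ) := by
    intro g hg
    induction hg using Submodule.span_induction with
    | mem g hg =>
      obtain ⟨x, v, rfl⟩ := hg
      have : (RKHS.kerFun H x v : X → ℝ) = fun y => v * k y x := by
        funext y
        rw [RKHS.kerFun_apply, ← hk, ← smul_eq_mul, ← map_smul, smul_eq_mul, mul_one]
      rw [this]
      exact (hk_meas.comp (measurable_id.prodMk measurable_const)).const_mul v
    | zero => simpa using measurable_zero
    | add a b _ _ ha hb => simpa using ha.add hb
    | smul c a _ ha => simpa using ha.const_smul c
  have hmem : h ∈ (Submodule.span ℝ {RKHS.kerFun H x v | (x : X) (v : ℝ)}).topologicalClosure := by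
    rw [RKHS.kerFun_dense]; trivial
  -- Norm convergence implies pointwise convergence because evaluations are continuous.
  obtain ⟨u, hu, hlim⟩ := mem_closure_iff_seq_limit.1 hmem
  refine measurable_of_tendsto_metrizable (fun n => hspan (u n) (hu n)) (tendsto_pi_nhds.2 ?_)
  exact fun x => ((RKHS.continuous_eval x).tendsto h).comp hlim

theorem memLp_rkhs {k : X → X → ℝ} (hk_meas : Measurable (Function.uncurry k))
    (hk : ∀ x y, RKHS.kernel H x y (1 : ℝ) = k x y) {M : ℝ} (hM : ∀ x y, |k x y| ≤ M)
    (P : Measure X) [IsFiniteMeasure P] (h : H) : MemLp h 2 P := by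
  refine MemLp.of_bound (measurable_rkhs hk_meas hk h).aestronglyMeasurable (√(M * ‖h‖ ^ 2))
    (ae_of_all _ fun x => ?_)
  rw [Real.norm_eq_abs]
  exact Real.abs_le_sqrt (sq_apply_le hk hM h x)

/-- The inclusion of a reproducing kernel Hilbert space with bounded measurable kernel in `L²`. -/
noncomputable def rkhsToLp {k : X → X → ℝ} (hk_meas : Measurable (Function.uncurry k))
    (hk : ∀ x y, RKHS.kernel H x y (1 : ℝ) = k x y) {M : ℝ} (hM : ∀ x y, |k x y| ≤ M)
    (P : Measure X) [IsProbabilityMeasure P] : H →L[ℝ] Lp ℝ 2 P :=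
  LinearMap.mkContinuous
    { toFun := fun h => (memLp_rkhs hk_meas hk hM P h).toLp h
      map_add' := fun a b => by
        rw [← MemLp.toLp_add]
        exact MemLp.toLp_congr _ _ (by simp)
      map_smul' := fun c a => by
        rw [RingHom.id_apply, ← MemLp.toLp_const_smul]
        exact MemLp.toLp_congr _ _ (by simp) }
    (√M) (fun h => by
      refine (Lp.norm_le_of_ae_bound (C := √M * ‖h‖) (by positivity) ?_).trans_eq ?_
      · filter_upwards [(memLp_rkhs hk_meas hk hM P h).coeFn_toLp] with x hx
        simp only [LinearMap.coe_mk, AddHom.coe_mk]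
        rw [hx, Real.norm_eq_abs]
        refine (Real.abs_le_sqrt (sq_apply_le hk hM h x)).trans ?_
        rw [Real.sqrt_mul' _ (sq_nonneg _), Real.sqrt_sq (norm_nonneg _)]
      · simp [measureUnivNNReal])

theorem inner_toLp_rkhsToLp {k : X → X → ℝ} (hk_meas : Measurable (Function.uncurry k))
    (hk : ∀ x y, RKHS.kernel H x y (1 : ℝ) = k x y) {M : ℝ} (hM : ∀ x y, |k x y| ≤ M)
    (P : Measure X) [IsProbabilityMeasure P] {w : X → ℝ} (hw : MemLp w 2 P) (h : H) :
    inner ℝ (hw.toLp w) (rkhsToLp hk_meas hk hM P h) = ∫ x, w x * h x ∂P := by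
  rw [L2.inner_def]
  refine integral_congr_ae ?_
  filter_upwards [hw.coeFn_toLp, (memLp_rkhs hk_meas hk hM P h).coeFn_toLp] with x h1 h2
  have h3 : rkhsToLp hk_meas hk hM P h x = h x := h2
  rw [h1, h3]
  simp [mul_comm]

theorem inner_rkhsToLp {k : X → X → ℝ} (hk_meas : Measurable (Function.uncurry k))
    (hk : ∀ x y, RKHS.kernel H x y (1 : ℝ) = k x y) {M : ℝ} (hM : ∀ x y, |k x y| ≤ M)
    (P : Measure X) [IsProbabilityMeasure P] (g h : H) :
    inner ℝ (rkhsToLp hk_meas hk hM P g) (rkhsToLp hk_meas hk hM P h) = ∫ x, g x * h x ∂P :=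
  inner_toLp_rkhsToLp hk_meas hk hM P (memLp_rkhs hk_meas hk hM P g) h

/-- If `f = K w` with `w ∈ L²`, then `⟨f, h⟩ = ⟨w, h⟩_{L²}` for all `h` in the reproducing kernel
Hilbert space. -/
theorem inner_eq_inner_toLp_of_eq_kernelOp {k : X → X → ℝ}
    (hk_meas : Measurable (Function.uncurry k))
    (hk : ∀ x y, RKHS.kernel H x y (1 : ℝ) = k x y) {M : ℝ} (hM : ∀ x y, |k x y| ≤ M)
    (P : Measure X) [IsProbabilityMeasure P] {w : X → ℝ} (hw : MemLp w 2 P) {f : H}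
    (hf : ⇑f = kernelOp k P w) (h : H) :
    inner ℝ f h = inner ℝ (hw.toLp w) (rkhsToLp hk_meas hk hM P h) := by
  -- `S* w` takes the value `⟨w, S k(·, x)⟩ = K w (x)` at `x`, so it is `f`.
  have : f = (rkhsToLp hk_meas hk hM P).adjoint (hw.toLp w) := by
    refine RKHS.ext fun x => ?_
    rw [← inner_kerFun_one ((rkhsToLp hk_meas hk hM P).adjoint (hw.toLp w)) x, real_inner_comm,
      ContinuousLinearMap.adjoint_inner_left, inner_toLp_rkhsToLp, hf, kernelOp]
    refine integral_congr_ae (ae_of_all _ fun y => ?_)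
    simp only
    rw [← inner_kerFun_one, real_inner_comm, inner_kerFun_kerFun hk, mul_comm]
  rw [this, ContinuousLinearMap.adjoint_inner_left]

end RKHSFacts

/-! ### Bias of Tikhonov regularization -/

section Regularization

variable {H E : Type*} [NormedAddCommGroup H] [InnerProductSpace ℝ H]
  [NormedAddCommGroup E] [InnerProductSpace ℝ E]

/-- The bias equation `(l + S* S) g = l f` of Tikhonov regularization has a solution. -/
theorem exists_tikhonov_bias [CompleteSpace H] (S : H →L[ℝ] E) {l : ℝ} (hl : 0 < l) (f : H) :
    ∃ g : H, ∀ h : H, l * inner ℝ g h + inner ℝ (S g) (S h) = l * inner ℝ f h := by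
  -- Lax–Milgram: the form is coercive with constant `l`.
  let B : H →L[ℝ] H →L[ℝ] ℝ := l • innerSL ℝ + (innerSL ℝ).bilinearComp S S
  have hB : ∀ g h, B g h = l * inner ℝ g h + inner ℝ (S g) (S h) := fun g h => by
    rfl
  have hco : IsCoercive B := by
    refine ⟨l, hl, fun u => ?_⟩
    rw [hB, real_inner_self_eq_norm_sq, real_inner_self_eq_norm_sq]
    nlinarith [sq_nonneg ‖S u‖]
  refine ⟨hco.continuousLinearEquivOfBilin.symm (l • f), fun h => ?_⟩
  rw [← hB, ← hco.continuousLinearEquivOfBilin_apply, ContinuousLinearEquiv.apply_symm_apply,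
    real_inner_smul_left]

variable {S : H →L[ℝ] E} {l : ℝ} {f g : H}

/-- Test with `h = g`. This bound, free of `l`, keeps the variance constant independent of `l`. -/
theorem norm_tikhonov_bias_le (hl : 0 < l)
    (hg : ∀ h : H, l * inner ℝ g h + inner ℝ (S g) (S h) = l * inner ℝ f h) : ‖g‖ ≤ ‖f‖ := by
  have h1 := hg g
  rw [real_inner_self_eq_norm_sq, real_inner_self_eq_norm_sq] at h1
  have h2 : l * ‖g‖ ^ 2 ≤ l * (‖f‖ * ‖g‖) := by
    nlinarith [sq_nonneg ‖S g‖, mul_le_mul_of_nonneg_left (real_inner_le_norm f g) hl.le]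
  have h3 := le_of_mul_le_mul_left h2 hl
  by_contra! h
  nlinarith [norm_nonneg f, norm_nonneg g]

theorem norm_map_tikhonov_bias_le (hl : 0 < l)
    (hg : ∀ h : H, l * inner ℝ g h + inner ℝ (S g) (S h) = l * inner ℝ f h) {w : E}
    (hw : ∀ h : H, inner ℝ f h = inner ℝ w (S h)) : ‖S g‖ ≤ l * ‖w‖ := by
  have h1 := hg g
  rw [hw, real_inner_self_eq_norm_sq, real_inner_self_eq_norm_sq] at h1
  have h2 : ‖S g‖ ^ 2 ≤ l * ‖w‖ * ‖S g‖ := by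
    nlinarith [mul_nonneg hl.le (sq_nonneg ‖g‖),
      mul_le_mul_of_nonneg_left (real_inner_le_norm w (S g)) hl.le]
  by_contra! h
  have : 0 ≤ l * ‖w‖ := by positivity
  nlinarith

/-- Testing with `h = l w - g` gives `l ⟨g, l w - g⟩ = ‖S (l w - g)‖² ≥ 0`, hence `‖g‖² ≤ l ⟨g, w⟩`.
-/
theorem norm_tikhonov_bias_le_of_source (hl : 0 < l)
    (hg : ∀ h : H, l * inner ℝ g h + inner ℝ (S g) (S h) = l * inner ℝ f h) {w : H}
    (hw : ∀ h : H, inner ℝ f h = inner ℝ (S w) (S h)) : ‖g‖ ≤ l * ‖w‖ := by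
  have h1 := hg (l • w - g)
  rw [hw] at h1
  have h0 : 0 ≤ inner ℝ (S (l • w - g)) (S (l • w - g)) := real_inner_self_nonneg
  simp only [map_sub, map_smul, inner_sub_left, inner_sub_right, real_inner_smul_left,
    real_inner_smul_right] at h1 h0
  have h2 : 0 ≤ l * (l * inner ℝ g w - inner ℝ g g) := by
    linarith
  have h3 := nonneg_of_mul_nonneg_right h2 hl
  rw [real_inner_self_eq_norm_sq] at h3
  have h4 := mul_le_mul_of_nonneg_left (real_inner_le_norm g w) hl.le
  by_contra! h
  have : 0 ≤ l * ‖w‖ := by positivity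
  nlinarith

end Regularization

/-! ### Variance of a mean of independent Hilbert-space vectors -/

section Variance

variable {α : Type*} [MeasurableSpace α] {ρ : Measure α} [IsProbabilityMeasure ρ]
  {E : Type*} [NormedAddCommGroup E] [InnerProductSpace ℝ E] {Ψ : α → E}

theorem measurable_norm_of_measurable_inner
    (hmeas : Measurable fun p : α × α => inner ℝ (Ψ p.1) (Ψ p.2)) :
    Measurable fun a => ‖Ψ a‖ := by
  have h : (fun a => ‖Ψ a‖) = fun a => √(inner ℝ (Ψ a) (Ψ a)) := by
    funext a
    rw [real_inner_self_eq_norm_sq, Real.sqrt_sq (norm_nonneg _)]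
  rw [h]
  exact (hmeas.comp (measurable_id.prodMk measurable_id)).sqrt

theorem integrable_prod_inner
    (hmeas : Measurable fun p : α × α => inner ℝ (Ψ p.1) (Ψ p.2))
    (hint : Integrable (fun a => ‖Ψ a‖ ^ 2) ρ) :
    Integrable (fun p : α × α => inner ℝ (Ψ p.1) (Ψ p.2)) (ρ.prod ρ) := by
  have h1 : Integrable (fun a => ‖Ψ a‖) ρ :=
    ((memLp_two_iff_integrable_sq
      (measurable_norm_of_measurable_inner hmeas).aestronglyMeasurable).2 hint).integrable
        one_le_two
  refine (h1.mul_prod h1).mono' hmeas.aestronglyMeasurable (ae_of_all _ fun p => ?_)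
  exact abs_real_inner_le_norm _ _

theorem map_eval_pair_pi {n : ℕ} {i j : Fin n} (hij : i ≠ j) :
    (Measure.pi fun _ : Fin n => ρ).map (fun z => (z i, z j)) = ρ.prod ρ := by
  have hind : IndepFun (fun z : Fin n → α => z i) (fun z => z j) (Measure.pi fun _ => ρ) :=
    (iIndepFun_pi (μ := fun _ : Fin n => ρ) (X := fun _ => id)
      (fun _ => aemeasurable_id)).indepFun hij
  rw [(indepFun_iff_map_prod_eq_prod_map_map (measurable_pi_apply i).aemeasurable
    (measurable_pi_apply j).aemeasurable).1 hind]
  have h := fun i => (measurePreserving_eval (fun _ : Fin n => ρ) i).map_eq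
  exact congrArg₂ _ (h i) (h j)

/-- The variance of the mean of independent copies of a weakly centred random vector, of which
only the inner product of two copies is assumed to be measurable. -/
theorem integral_norm_sq_mean_of_centred
    (hmeas : Measurable fun p : α × α => inner ℝ (Ψ p.1) (Ψ p.2))
    (hint : Integrable (fun a => ‖Ψ a‖ ^ 2) ρ) (hzero : ∀ h, ∫ a, inner ℝ (Ψ a) h ∂ρ = 0)
    {n : ℕ} (hn : n ≠ 0) :
    Integrable (fun z : Fin n → α => ‖(n : ℝ)⁻¹ • ∑ i, Ψ (z i)‖ ^ 2) (Measure.pi fun _ => ρ) ∧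
      ∫ z : Fin n → α, ‖(n : ℝ)⁻¹ • ∑ i, Ψ (z i)‖ ^ 2 ∂(Measure.pi fun _ => ρ)
        = (n : ℝ)⁻¹ * ∫ a, ‖Ψ a‖ ^ 2 ∂ρ := by
  have hexp : ∀ z : Fin n → α, ‖(n : ℝ)⁻¹ • ∑ i, Ψ (z i)‖ ^ 2
      = ((n : ℝ)⁻¹) ^ 2 * ∑ i, ∑ j, inner ℝ (Ψ (z i)) (Ψ (z j)) := by
    intro z
    rw [norm_smul, mul_pow, Real.norm_eq_abs, sq_abs, ← real_inner_self_eq_norm_sq, sum_inner]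
    simp only [inner_sum]
  have hev : ∀ i : Fin n, MeasurePreserving (fun z : Fin n → α => z i)
      (Measure.pi fun _ => ρ) ρ := fun i => measurePreserving_eval (fun _ : Fin n => ρ) i
  have hpair : ∀ i j : Fin n, i ≠ j → MeasurePreserving (fun z : Fin n → α => (z i, z j))
      (Measure.pi fun _ => ρ) (ρ.prod ρ) := fun i j hij =>
    ⟨(measurable_pi_apply i).prodMk (measurable_pi_apply j), map_eval_pair_pi hij⟩
  have hc : ∀ i j : Fin n,
      Integrable (fun z : Fin n → α => inner ℝ (Ψ (z i)) (Ψ (z j))) (Measure.pi fun _ => ρ) ∧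
      ∫ z : Fin n → α, inner ℝ (Ψ (z i)) (Ψ (z j)) ∂(Measure.pi fun _ => ρ)
        = if i = j then ∫ a, ‖Ψ a‖ ^ 2 ∂ρ else 0 := by
    intro i j
    by_cases hij : i = j
    · subst hij
      simp only [real_inner_self_eq_norm_sq, if_true]
      refine ⟨(hev i).integrable_comp_of_integrable hint, ?_⟩
      have h := integral_map (hev i).aemeasurable (f := fun a => ‖Ψ a‖ ^ 2)
        (by rw [(hev i).map_eq]; exact hint.aestronglyMeasurable)
      rw [← h, (hev i).map_eq]
    · have hI := integrable_prod_inner hmeas hint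
      refine ⟨(hpair i j hij).integrable_comp_of_integrable hI, ?_⟩
      rw [if_neg hij]
      -- Fubini: with one copy fixed, weak centring makes the inner integral vanish.
      have h1 : ∫ p, inner ℝ (Ψ p.1) (Ψ p.2) ∂(ρ.prod ρ) = 0 := by
        rw [integral_prod _ hI]
        have h2 : ∀ x, ∫ y, inner ℝ (Ψ x) (Ψ y) ∂ρ = 0 := fun x => by
          simp only [real_inner_comm _ (Ψ x)]
          exact hzero _
        simp [h2]
      have h2 := integral_map (hpair i j hij).aemeasurable hmeas.aestronglyMeasurable
      rw [← h2, (hpair i j hij).map_eq, h1]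
  constructor
  · simp only [hexp]
    exact (integrable_finsetSum _ fun i _ => integrable_finsetSum _ fun j _ =>
      (hc i j).1).const_mul _
  · simp only [hexp]
    rw [integral_const_mul, integral_finsetSum _ fun i _ => integrable_finsetSum _ fun j _ =>
      (hc i j).1]
    have : ∀ i : Fin n, ∫ z : Fin n → α, ∑ j, inner ℝ (Ψ (z i)) (Ψ (z j))
        ∂(Measure.pi fun _ => ρ) = ∫ a, ‖Ψ a‖ ^ 2 ∂ρ := by
      intro i
      rw [integral_finsetSum _ fun j _ => (hc i j).1]
      simp [(hc i _).2]
    simp only [this, Finset.sum_const, Finset.card_univ, Fintype.card_fin, nsmul_eq_mul]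
    field_simp

/-- Centre `Φ` at its weak mean `v`; the variance is the second moment minus `‖v‖²`, which is
dropped. -/
theorem integral_norm_sq_mean_sub_le {Φ : α → E} {v : E}
    (hmeas : Measurable fun p : α × α => inner ℝ (Φ p.1) (Φ p.2))
    (hmeas' : Measurable fun a => inner ℝ (Φ a) v)
    (hint : Integrable (fun a => ‖Φ a‖ ^ 2) ρ)
    (hint' : ∀ h, Integrable (fun a => inner ℝ (Φ a) h) ρ)
    (hmean : ∀ h, ∫ a, inner ℝ (Φ a) h ∂ρ = inner ℝ v h) {n : ℕ} (hn : n ≠ 0) :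
    Integrable (fun z : Fin n → α => ‖(n : ℝ)⁻¹ • ∑ i, Φ (z i) - v‖ ^ 2)
        (Measure.pi fun _ => ρ) ∧
      ∫ z : Fin n → α, ‖(n : ℝ)⁻¹ • ∑ i, Φ (z i) - v‖ ^ 2 ∂(Measure.pi fun _ => ρ)
        ≤ (n : ℝ)⁻¹ * ∫ a, ‖Φ a‖ ^ 2 ∂ρ := by
  have hsum : ∀ z : Fin n → α, (n : ℝ)⁻¹ • ∑ i, Φ (z i) - v
      = (n : ℝ)⁻¹ • ∑ i, (Φ (z i) - v) := by
    intro z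
    have hn' : (n : ℝ) ≠ 0 := by exact_mod_cast hn
    rw [Finset.sum_sub_distrib, smul_sub]
    simp [← Nat.cast_smul_eq_nsmul ℝ, smul_smul, hn']
  have hsq : ∀ a, ‖Φ a - v‖ ^ 2 = ‖Φ a‖ ^ 2 - 2 * inner ℝ (Φ a) v + ‖v‖ ^ 2 :=
    fun a => norm_sub_sq_real _ _
  have hsqint : Integrable (fun a => ‖Φ a‖ ^ 2 - 2 * inner ℝ (Φ a) v) ρ :=
    hint.sub ((hint' v).const_mul 2)
  obtain ⟨h1, h2⟩ := integral_norm_sq_mean_of_centred (ρ := ρ) (Ψ := fun a => Φ a - v) (by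
      have : (fun p : α × α => inner ℝ (Φ p.1 - v) (Φ p.2 - v)) = fun p =>
          inner ℝ (Φ p.1) (Φ p.2) - inner ℝ (Φ p.1) v - inner ℝ (Φ p.2) v + inner ℝ v v := by
        funext p
        simp only [inner_sub_left, inner_sub_right, real_inner_comm (Φ p.2) v]
        ring
      rw [this]
      exact ((hmeas.sub (hmeas'.comp measurable_fst)).sub
        (hmeas'.comp measurable_snd)).add_const _)
    (by simp only [hsq]; exact hsqint.add (integrable_const _))
    (fun h => by
      simp only [inner_sub_left]
      rw [integral_sub (hint' h) (integrable_const _), hmean]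
      simp) hn
  simp only [hsum]
  refine ⟨h1, h2.trans_le ?_⟩
  gcongr ?_ * ?_
  simp only [hsq]
  rw [integral_add hsqint (integrable_const _), integral_sub hint ((hint' v).const_mul 2),
    integral_const_mul, hmean, real_inner_self_eq_norm_sq]
  simp
  nlinarith [sq_nonneg ‖v‖]

end Variance

/-! ### Normal equation, stability and measurability of the estimator -/

section Estimator

variable {X : Type*} {H : Type*} [NormedAddCommGroup H] [InnerProductSpace ℝ H]
  [CompleteSpace H] [RKHS ℝ H X ℝ] {k : X → X → ℝ}

/-- The matrix of the linear system that determines the weights. -/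
theorem posDef_smul_one_add_gramMatrix (hk : ∀ x y, RKHS.kernel H x y (1 : ℝ) = k x y)
    {l : ℝ} (hl : 0 < l) {n : ℕ} (z : Fin n → X × ℝ) :
    (l • (1 : Matrix (Fin n) (Fin n) ℝ) + (n : ℝ)⁻¹ • gramMatrix k z).PosDef := by
  have hG : gramMatrix k z = Matrix.gram ℝ fun i => RKHS.kerFun H (z i).1 (1 : ℝ) := by
    ext i j
    rw [Matrix.gram_apply, inner_kerFun_kerFun hk, gramMatrix, Matrix.of_apply]
  rw [hG]
  exact (Matrix.PosDef.one.smul hl).add_posSemidef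
    ((Matrix.posSemidef_gram ℝ _).smul (by positivity))

theorem krrEstimator_apply (hk : ∀ x y, RKHS.kernel H x y (1 : ℝ) = k x y) (l : ℝ) {n : ℕ}
    (z : Fin n → X × ℝ) (x : X) :
    krrEstimator H k l z x = (n : ℝ)⁻¹ * ∑ i, krrWeights k l z i * k x (z i).1 := by
  rw [← inner_kerFun_one, krrEstimator, real_inner_smul_right, inner_sum]
  simp only [real_inner_smul_right, inner_kerFun_kerFun hk]

theorem krrWeights_add_krrEstimator (hk : ∀ x y, RKHS.kernel H x y (1 : ℝ) = k x y)
    {l : ℝ} (hl : 0 < l) {n : ℕ} (z : Fin n → X × ℝ) (i : Fin n) :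
    l * krrWeights k l z i + krrEstimator H k l z (z i).1 = (z i).2 := by
  have hA := (posDef_smul_one_add_gramMatrix hk hl z).isUnit
  have h : (l • (1 : Matrix (Fin n) (Fin n) ℝ) + (n : ℝ)⁻¹ • gramMatrix k z).mulVec
      (krrWeights k l z) = fun i => (z i).2 := by
    rw [krrWeights, Matrix.mulVec_mulVec,
      Matrix.mul_nonsing_inv _ ((Matrix.isUnit_iff_isUnit_det _).1 hA), Matrix.one_mulVec]
  rw [← congrFun h i, krrEstimator_apply hk, Matrix.add_mulVec, Matrix.smul_mulVec,
    Matrix.smul_mulVec, Matrix.one_mulVec]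
  simp [Matrix.mulVec, dotProduct, gramMatrix, mul_comm]

/-- The estimator solves the regularized normal equation; here it is stated for the deviation of
the estimator from an arbitrary element of the space. -/
theorem krrEstimator_sub_normal_equation (hk : ∀ x y, RKHS.kernel H x y (1 : ℝ) = k x y)
    {l : ℝ} (hl : 0 < l) {n : ℕ} (z : Fin n → X × ℝ) (g : H) :
    l • (krrEstimator H k l z - g) +
        (n : ℝ)⁻¹ • ∑ i, (krrEstimator H k l z - g) (z i).1 • RKHS.kerFun H (z i).1 (1 : ℝ)
      = (n : ℝ)⁻¹ • ∑ i, ((z i).2 - g (z i).1) • RKHS.kerFun H (z i).1 (1 : ℝ) - l • g := by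
  -- The linear system says that `l ŵ_i` is the residual `f_i - f̂(x_i)`.
  have h1 : l • krrEstimator H k l z = (n : ℝ)⁻¹ • ∑ i,
      ((z i).2 - krrEstimator H k l z (z i).1) • RKHS.kerFun H (z i).1 (1 : ℝ) := by
    conv_lhs => rw [krrEstimator]
    rw [smul_comm, Finset.smul_sum]
    congr 1
    refine Finset.sum_congr rfl fun i _ => ?_
    rw [smul_smul]
    congr 1
    linarith [krrWeights_add_krrEstimator hk hl z i]
  rw [smul_sub, h1]
  simp only [RKHS.coe_sub, Pi.sub_apply, sub_smul, Finset.sum_sub_distrib, smul_sub]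
  abel

/-- Pair the normal equation with the deviation `d`: the empirical operator contributes the mean of
`d(x_i)²`, which is nonnegative. -/
theorem norm_krrEstimator_sub_le (hk : ∀ x y, RKHS.kernel H x y (1 : ℝ) = k x y)
    {l : ℝ} (hl : 0 < l) {n : ℕ} (z : Fin n → X × ℝ) (g : H) :
    l * ‖krrEstimator H k l z - g‖ ≤
      ‖(n : ℝ)⁻¹ • ∑ i, ((z i).2 - g (z i).1) • RKHS.kerFun H (z i).1 (1 : ℝ) - l • g‖ := by
  rw [← krrEstimator_sub_normal_equation hk hl z g]
  set d := krrEstimator H k l z - g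
  set r := l • d + (n : ℝ)⁻¹ • ∑ i, d (z i).1 • RKHS.kerFun H (z i).1 (1 : ℝ) with hr
  have h1 : inner ℝ r d = l * ‖d‖ ^ 2 + (n : ℝ)⁻¹ * ∑ i, (d (z i).1) ^ 2 := by
    rw [hr, inner_add_left, real_inner_smul_left, real_inner_smul_left, sum_inner,
      real_inner_self_eq_norm_sq]
    simp only [real_inner_smul_left, inner_kerFun_one, pow_two]
  have h2 : 0 ≤ (n : ℝ)⁻¹ * ∑ i, (d (z i).1) ^ 2 := by positivity
  have h3 := real_inner_le_norm r d
  by_contra! h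
  have h4 : ‖r‖ * ‖d‖ ≤ l * ‖d‖ * ‖d‖ := by gcongr
  have h5 : 0 < ‖d‖ := by
    by_contra! h0
    nlinarith [norm_nonneg r, norm_nonneg d]
  have h6 : ‖r‖ * ‖d‖ < l * ‖d‖ * ‖d‖ := by gcongr
  nlinarith

theorem norm_krrEstimator_sub_sq_le (hk : ∀ x y, RKHS.kernel H x y (1 : ℝ) = k x y)
    {l : ℝ} (hl : 0 < l) {n : ℕ} (z : Fin n → X × ℝ) (g : H) :
    ‖krrEstimator H k l z - g‖ ^ 2 ≤ (l ^ 2)⁻¹ *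
      ‖(n : ℝ)⁻¹ • ∑ i, ((z i).2 - g (z i).1) • RKHS.kerFun H (z i).1 (1 : ℝ) - l • g‖ ^ 2 := by
  rw [inv_mul_eq_div, le_div_iff₀ (by positivity), mul_comm, ← mul_pow]
  gcongr
  exact norm_krrEstimator_sub_le hk hl z g

variable [MeasurableSpace X]

theorem measurable_matrix_det {α : Type*} [MeasurableSpace α] {n : ℕ}
    {A : α → Matrix (Fin n) (Fin n) ℝ} (hA : ∀ i j, Measurable fun a => A a i j) :
    Measurable fun a => (A a).det := by
  simp only [Matrix.det_apply]
  exact Finset.measurable_sum _ fun σ _ =>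
    (Finset.measurable_prod _ fun i _ => hA _ _).const_smul _

theorem measurable_matrix_inv {α : Type*} [MeasurableSpace α] {n : ℕ}
    {A : α → Matrix (Fin n) (Fin n) ℝ} (hA : ∀ i j, Measurable fun a => A a i j) (i j : Fin n) :
    Measurable fun a => (A a)⁻¹ i j := by
  simp only [Matrix.inv_def, Ring.inverse_eq_inv', Matrix.smul_apply, Matrix.adjugate_apply,
    smul_eq_mul]
  refine (measurable_matrix_det hA).inv.mul (measurable_matrix_det fun p q => ?_)
  simp only [Matrix.updateRow_apply]
  split_ifs
  · exact measurable_const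
  · exact hA p q

theorem measurable_krrWeights (hk_meas : Measurable (Function.uncurry k)) (l : ℝ) {n : ℕ}
    (i : Fin n) : Measurable fun z : Fin n → X × ℝ => krrWeights k l z i := by
  simp only [krrWeights, Matrix.mulVec, dotProduct]
  refine Finset.measurable_sum _ fun j _ => ?_
  refine (measurable_matrix_inv (fun p q => ?_) i j).mul (measurable_snd.comp
    (measurable_pi_apply j))
  simp only [Matrix.add_apply, Matrix.smul_apply, gramMatrix, Matrix.of_apply, smul_eq_mul]
  refine measurable_const.add (Measurable.const_mul ?_ _)
  exact hk_meas.comp ((measurable_fst.comp (measurable_pi_apply p)).prodMk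
    (measurable_fst.comp (measurable_pi_apply q)))

theorem measurable_krrEstimator_apply (hk_meas : Measurable (Function.uncurry k))
    (hk : ∀ x y, RKHS.kernel H x y (1 : ℝ) = k x y) (l : ℝ) {n : ℕ} :
    Measurable fun p : (Fin n → X × ℝ) × X => krrEstimator H k l p.1 p.2 := by
  simp only [krrEstimator_apply hk]
  refine (Finset.measurable_sum _ fun i _ => ?_).const_mul _
  refine ((measurable_krrWeights hk_meas l i).comp measurable_fst).mul ?_
  exact hk_meas.comp (measurable_snd.prodMk
    (measurable_fst.comp ((measurable_pi_apply i).comp measurable_fst)))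

/-- The reproducing property turns the squared norm into finite sums of measurable real functions.
-/
theorem measurable_norm_sub_krrEstimator_sq (hk_meas : Measurable (Function.uncurry k))
    (hk : ∀ x y, RKHS.kernel H x y (1 : ℝ) = k x y) (f : H) (l : ℝ) (n : ℕ) :
    Measurable fun z : Fin n → X × ℝ => ‖f - krrEstimator H k l z‖ ^ 2 := by
  have hinner : ∀ (g : H) (z : Fin n → X × ℝ), inner ℝ g (krrEstimator H k l z) =
      (n : ℝ)⁻¹ * ∑ i, krrWeights k l z i * g (z i).1 := by
    intro g z
    rw [krrEstimator, real_inner_smul_right, inner_sum]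
    simp only [real_inner_comm _ g, real_inner_smul_left, inner_kerFun_one]
  have hcoord : ∀ i : Fin n, Measurable fun z : Fin n → X × ℝ => (z i).1 := fun i =>
    measurable_fst.comp (measurable_pi_apply i)
  have h : (fun z : Fin n → X × ℝ => ‖f - krrEstimator H k l z‖ ^ 2) = fun z =>
      ‖f‖ ^ 2 - 2 * ((n : ℝ)⁻¹ * ∑ i, krrWeights k l z i * f (z i).1)
        + (n : ℝ)⁻¹ * ∑ i, krrWeights k l z i * krrEstimator H k l z (z i).1 := by
    funext z
    rw [norm_sub_sq_real, hinner, ← real_inner_self_eq_norm_sq (krrEstimator H k l z), hinner]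
  rw [h]
  refine (measurable_const.sub (((Finset.measurable_sum _ fun i _ => ?_).const_mul _).const_mul
    _)).add ((Finset.measurable_sum _ fun i _ => ?_).const_mul _)
  · exact (measurable_krrWeights hk_meas l i).mul ((measurable_rkhs hk_meas hk f).comp (hcoord i))
  · have hest : Measurable fun z : Fin n → X × ℝ => krrEstimator H k l z (z i).1 :=
      (measurable_krrEstimator_apply hk_meas hk l).comp
        (g := fun p : (Fin n → X × ℝ) × X => krrEstimator H k l p.1 p.2)
        (f := fun z : Fin n → X × ℝ => (z, (z i).1)) (measurable_id.prodMk (hcoord i))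
    exact (measurable_krrWeights hk_meas l i).mul hest

theorem stronglyMeasurable_integral_sub_krrEstimator_sq
    (hk_meas : Measurable (Function.uncurry k))
    (hk : ∀ x y, RKHS.kernel H x y (1 : ℝ) = k x y) (f : H) (l : ℝ) (n : ℕ) (P : Measure X)
    [SFinite P] :
    StronglyMeasurable fun z : Fin n → X × ℝ => ∫ x, (f x - krrEstimator H k l z x) ^ 2 ∂P := by
  refine StronglyMeasurable.integral_prod_right'
    (f := fun p : (Fin n → X × ℝ) × X => (f p.2 - krrEstimator H k l p.1 p.2) ^ 2) ?_
  exact ((((measurable_rkhs hk_meas hk f).comp measurable_snd).sub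
    (measurable_krrEstimator_apply hk_meas hk l)).pow_const 2).stronglyMeasurable

end Estimator

/-! ### Mean and second moment of the residual -/

section Noise

variable {X : Type*} {H : Type*} [NormedAddCommGroup H] [InnerProductSpace ℝ H]
  [CompleteSpace H] [RKHS ℝ H X ℝ] {k : X → X → ℝ} [MeasurableSpace X]
  {ρ : Measure (X × ℝ)} {M : ℝ}

theorem integral_rkhs_mul_comp_fst (hk_meas : Measurable (Function.uncurry k))
    (hk : ∀ x y, RKHS.kernel H x y (1 : ℝ) = k x y) (g h : H) :
    ∫ z, g z.1 * h z.1 ∂ρ = ∫ x, g x * h x ∂ρ.fst := by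
  rw [Measure.fst, integral_map measurable_fst.aemeasurable]
  exact ((measurable_rkhs hk_meas hk g).mul (measurable_rkhs hk_meas hk h)).aestronglyMeasurable

variable [IsProbabilityMeasure ρ]

theorem memLp_rkhs_comp_fst (hk_meas : Measurable (Function.uncurry k))
    (hk : ∀ x y, RKHS.kernel H x y (1 : ℝ) = k x y) (hM : ∀ x y, |k x y| ≤ M)
    (h : H) : MemLp (fun z : X × ℝ => h z.1) 2 ρ :=
  (memLp_rkhs hk_meas hk hM ρ.fst h).comp_measurePreserving ⟨measurable_fst, rfl⟩

/-- `h(X)` is measurable for the conditioning σ-algebra, so it can be pulled out of the conditional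
expectation. -/
theorem integral_snd_mul_rkhs_of_isRegressionFunction (hk_meas : Measurable (Function.uncurry k))
    (hk : ∀ x y, RKHS.kernel H x y (1 : ℝ) = k x y) (hM : ∀ x y, |k x y| ≤ M)
    (hρ : MemLp (fun z : X × ℝ => z.2) 2 ρ) {f₀ : H} (hf₀ : IsRegressionFunction ρ f₀) (h : H) :
    ∫ z, z.2 * h z.1 ∂ρ = ∫ x, f₀ x * h x ∂ρ.fst := by
  rw [← integral_rkhs_mul_comp_fst hk_meas hk]
  have hm : MeasurableSpace.comap (Prod.fst : X × ℝ → X) inferInstance ≤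
      (inferInstance : MeasurableSpace (X × ℝ)) := measurable_fst.comap_le
  have hmeas : StronglyMeasurable[MeasurableSpace.comap (Prod.fst : X × ℝ → X) inferInstance]
      (fun z : X × ℝ => h z.1) :=
    ((measurable_rkhs hk_meas hk h).comp (comap_measurable _)).stronglyMeasurable
  have hint : Integrable ((fun z : X × ℝ => h z.1) * fun z : X × ℝ => z.2) ρ :=
    (memLp_rkhs_comp_fst hk_meas hk hM h).integrable_mul hρ
  have h1 := condExp_mul_of_stronglyMeasurable_left hmeas hint (hρ.integrable one_le_two)
  have h2 := integral_condExp hm (μ := ρ) (f := (fun z : X × ℝ => h z.1) * fun z : X × ℝ => z.2)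
  have h3 : ∫ z, z.2 * h z.1 ∂ρ = ∫ z, ((fun z : X × ℝ => h z.1) * fun z : X × ℝ => z.2) z ∂ρ := by
    simp only [Pi.mul_apply, mul_comm]
  rw [h3, ← h2]
  refine integral_congr_ae ?_
  filter_upwards [h1, hf₀] with z hz1 hz2
  rw [hz1, Pi.mul_apply, ← hz2, mul_comm]

/-- The mean square of the residual of the regularized normal equation at the regularized
regression function `f₀ - g`. -/
theorem integral_norm_sq_krr_residual_le (hk_meas : Measurable (Function.uncurry k))
    (hk : ∀ x y, RKHS.kernel H x y (1 : ℝ) = k x y) (hM : ∀ x y, |k x y| ≤ M)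
    (hρ : MemLp (fun z : X × ℝ => z.2) 2 ρ) {f₀ : H} (hf₀ : IsRegressionFunction ρ f₀)
    {l : ℝ} (hl : 0 < l) {g : H}
    (hg : ∀ h : H, l * inner ℝ g h + inner ℝ (rkhsToLp hk_meas hk hM ρ.fst g)
      (rkhsToLp hk_meas hk hM ρ.fst h) = l * inner ℝ f₀ h) {n : ℕ} (hn : n ≠ 0) :
    Integrable (fun z : Fin n → X × ℝ => ‖(n : ℝ)⁻¹ • ∑ i, ((z i).2 - (f₀ - g) (z i).1) •
        RKHS.kerFun H (z i).1 (1 : ℝ) - l • (f₀ - g)‖ ^ 2) (Measure.pi fun _ => ρ) ∧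
      ∫ z : Fin n → X × ℝ, ‖(n : ℝ)⁻¹ • ∑ i, ((z i).2 - (f₀ - g) (z i).1) •
        RKHS.kerFun H (z i).1 (1 : ℝ) - l • (f₀ - g)‖ ^ 2 ∂(Measure.pi fun _ => ρ)
        ≤ (n : ℝ)⁻¹ * (M * (2 * ∫ z, z.2 ^ 2 ∂ρ + 8 * (M * ‖f₀‖ ^ 2))) := by
  have hH := memLp_rkhs_comp_fst (ρ := ρ) hk_meas hk hM
  have hres : MemLp (fun z : X × ℝ => z.2 - (f₀ - g) z.1) 2 ρ := hρ.sub (hH (f₀ - g))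
  have hresmeas : Measurable fun z : X × ℝ => z.2 - (f₀ - g) z.1 :=
    measurable_snd.sub ((measurable_rkhs hk_meas hk _).comp measurable_fst)
  have hinner : ∀ h : H, (fun z : X × ℝ => inner ℝ ((z.2 - (f₀ - g) z.1) •
      RKHS.kerFun H z.1 (1 : ℝ)) h) = fun z => (z.2 - (f₀ - g) z.1) * h z.1 := by
    intro h
    funext z
    rw [real_inner_smul_left, inner_kerFun_one]
  have hnorm : (fun z : X × ℝ => ‖(z.2 - (f₀ - g) z.1) • RKHS.kerFun H z.1 (1 : ℝ)‖ ^ 2)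
      = fun z => (z.2 - (f₀ - g) z.1) ^ 2 * k z.1 z.1 := by
    funext z
    rw [norm_smul, mul_pow, Real.norm_eq_abs, sq_abs, ← real_inner_self_eq_norm_sq,
      inner_kerFun_kerFun hk]
  have hkdiag : Measurable fun z : X × ℝ => k z.1 z.1 :=
    hk_meas.comp (measurable_fst.prodMk measurable_fst)
  -- `‖f₀ - g‖ ≤ 2 ‖f₀‖` and `(a - b)² ≤ 2 a² + 2 b²` give the factor `8`.
  have hbound : ∀ z : X × ℝ, (z.2 - (f₀ - g) z.1) ^ 2 * k z.1 z.1 ≤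
      M * (2 * z.2 ^ 2 + 8 * (M * ‖f₀‖ ^ 2)) := by
    intro z
    have hM0 : 0 ≤ M := (abs_nonneg _).trans (hM z.1 z.1)
    have hg1 := norm_tikhonov_bias_le hl hg
    have h1 : ‖f₀ - g‖ ^ 2 ≤ 4 * ‖f₀‖ ^ 2 := by
      have : ‖f₀ - g‖ ≤ 2 * ‖f₀‖ := (norm_sub_le _ _).trans (by linarith)
      calc ‖f₀ - g‖ ^ 2 ≤ (2 * ‖f₀‖) ^ 2 := by gcongr
        _ = _ := by ring
    have h2 := (sq_apply_le hk hM (f₀ - g) z.1).trans (mul_le_mul_of_nonneg_left h1 hM0)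
    have h3 : (z.2 - (f₀ - g) z.1) ^ 2 ≤ 2 * z.2 ^ 2 + 8 * (M * ‖f₀‖ ^ 2) := by
      nlinarith [sq_nonneg (z.2 + (f₀ - g) z.1)]
    calc (z.2 - (f₀ - g) z.1) ^ 2 * k z.1 z.1 ≤ (z.2 - (f₀ - g) z.1) ^ 2 * M := by
          gcongr
          exact (le_abs_self _).trans (hM _ _)
      _ ≤ (2 * z.2 ^ 2 + 8 * (M * ‖f₀‖ ^ 2)) * M := by gcongr
      _ = _ := mul_comm _ _
  have hint : Integrable (fun z : X × ℝ => (z.2 - (f₀ - g) z.1) ^ 2 * k z.1 z.1) ρ :=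
    hres.integrable_sq.mul_bdd (c := M) hkdiag.aestronglyMeasurable
      (ae_of_all _ fun z => hM z.1 z.1)
  have hint' : ∀ h : H, Integrable (fun z : X × ℝ => (z.2 - (f₀ - g) z.1) * h z.1) ρ :=
    fun h => hres.integrable_mul (hH h)
  obtain ⟨h1, h2⟩ := integral_norm_sq_mean_sub_le (ρ := ρ)
    (Φ := fun z : X × ℝ => (z.2 - (f₀ - g) z.1) • RKHS.kerFun H z.1 (1 : ℝ)) (v := l • (f₀ - g))
    (by
      simp only [real_inner_smul_left, real_inner_smul_right, inner_kerFun_kerFun hk]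
      exact (hresmeas.comp measurable_snd).mul ((hresmeas.comp measurable_fst).mul
        (hk_meas.comp ((measurable_fst.comp measurable_fst).prodMk
          (measurable_fst.comp measurable_snd)))))
    (by
      rw [hinner]
      exact hresmeas.mul ((measurable_rkhs hk_meas hk _).comp measurable_fst))
    (by rw [hnorm]; exact hint) (fun h => by rw [hinner]; exact hint' h)
    (fun h => by
      -- The weak mean is `⟨S g, S h⟩`, which the bias equation identifies with `l ⟨f₀ - g, h⟩`.
      rw [hinner]
      have h3 := hg h
      rw [inner_rkhsToLp] at h3
      have h4 : ∫ z : X × ℝ, (z.2 - (f₀ - g) z.1) * h z.1 ∂ρ =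
          ∫ z, z.2 * h z.1 ∂ρ - (∫ z, f₀ z.1 * h z.1 ∂ρ - ∫ z, g z.1 * h z.1 ∂ρ) := by
        have i0 : Integrable (fun z : X × ℝ => z.2 * h z.1) ρ := hρ.integrable_mul (hH h)
        have i1 : Integrable (fun z : X × ℝ => f₀ z.1 * h z.1) ρ := (hH f₀).integrable_mul (hH h)
        have i2 : Integrable (fun z : X × ℝ => g z.1 * h z.1) ρ := (hH g).integrable_mul (hH h)
        rw [← integral_sub i1 i2, ← integral_sub i0 (i1.sub' i2)]
        refine integral_congr_ae (ae_of_all _ fun z => ?_)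
        simp only [RKHS.coe_sub, Pi.sub_apply]
        ring
      rw [h4, integral_snd_mul_rkhs_of_isRegressionFunction hk_meas hk hM hρ hf₀,
        integral_rkhs_mul_comp_fst hk_meas hk, integral_rkhs_mul_comp_fst hk_meas hk,
        real_inner_smul_left, inner_sub_left]
      linarith) hn
  refine ⟨h1, h2.trans ?_⟩
  gcongr ?_ * ?_
  rw [hnorm]
  have hsq : Integrable (fun z : X × ℝ => z.2 ^ 2) ρ := hρ.integrable_sq
  calc ∫ z : X × ℝ, (z.2 - (f₀ - g) z.1) ^ 2 * k z.1 z.1 ∂ρ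
      ≤ ∫ z : X × ℝ, M * (2 * z.2 ^ 2 + 8 * (M * ‖f₀‖ ^ 2)) ∂ρ :=
        integral_mono hint (((hsq.const_mul 2).add (integrable_const _)).const_mul M) hbound
    _ = M * (2 * ∫ z, z.2 ^ 2 ∂ρ + 8 * (M * ‖f₀‖ ^ 2)) := by
        rw [integral_const_mul, integral_add (hsq.const_mul 2) (integrable_const _),
          integral_const_mul]
        simp

end Noise

/-! ### From residual to risk, and the rate -/

section Risk

theorem IsIIDSample.hasLaw_pi {X Ω : Type*} [MeasurableSpace X] [MeasurableSpace Ω]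
    {n : ℕ} {ρ : Measure (X × ℝ)} [IsProbabilityMeasure ρ] {μ : Measure Ω}
    [IsProbabilityMeasure μ] {Z : Fin n → Ω → X × ℝ} (hZ : IsIIDSample ρ μ Z) :
    HasLaw (fun ω i => Z i ω) (Measure.pi fun _ : Fin n => ρ) μ where
  aemeasurable := aemeasurable_pi_lambda _ fun i => (hZ.hasLaw i).aemeasurable
  map_eq := by
    rw [(iIndepFun_iff_map_fun_eq_pi_map fun i => (hZ.hasLaw i).aemeasurable).1 hZ.indep]
    simp only [(hZ.hasLaw _).map_eq]

theorem ProbabilityTheory.HasLaw.integral_comp_le_of_le {α Ω : Type*} [MeasurableSpace α]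
    [MeasurableSpace Ω] {ν : Measure α} {μ : Measure Ω} {Y : Ω → α} (hY : HasLaw Y ν μ)
    {Q D : α → ℝ} (hQ : StronglyMeasurable Q) (hQ0 : ∀ a, 0 ≤ Q a) (hQD : ∀ a, Q a ≤ D a)
    (hD : Integrable D ν) :
    Integrable (fun ω => Q (Y ω)) μ ∧ ∫ ω, Q (Y ω) ∂μ ≤ ∫ a, D a ∂ν := by
  have hQi : Integrable Q ν := hD.mono' hQ.aestronglyMeasurable
    (ae_of_all _ fun a => by rw [Real.norm_of_nonneg (hQ0 a)]; exact hQD a)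
  have hmap := integral_map hY.aemeasurable (f := Q) hQ.aestronglyMeasurable
  rw [hY.map_eq] at hmap
  refine ⟨?_, hmap ▸ integral_mono hQi hD hQD⟩
  rw [← hY.map_eq] at hQi
  exact hQi.comp_aemeasurable hY.aemeasurable

/-- Balance of squared bias and variance for a regularization parameter of exact order
`n ^ (-1/5)`. -/
theorem exists_rate_bound_of_isTheta {lam : ℕ → ℝ} (hpos : ∀ n, 1 ≤ n → 0 < lam n)
    (hlam : lam =Θ[atTop] (fun n : ℕ => (n : ℝ) ^ (-(1 / 5) : ℝ))) {a b : ℝ} (ha : 0 ≤ a)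
    (hb : 0 ≤ b) :
    ∃ B : ℝ, ∀ n : ℕ, 1 ≤ n →
      a * lam n ^ 2 + b * ((lam n ^ 2)⁻¹ * (n : ℝ)⁻¹) ≤ B * (n : ℝ) ^ (-(2 / 5) : ℝ) := by
  -- On `ℕ` the asymptotic bounds hold with one constant at every index where the comparison
  -- function is nonzero, hence for all `n ≥ 1`.
  obtain ⟨c, -, hc⟩ := bound_of_isBigO_nat_atTop hlam.1
  obtain ⟨d, -, hd⟩ := bound_of_isBigO_nat_atTop hlam.2
  refine ⟨a * c ^ 2 + b * d ^ 2, fun n hn => ?_⟩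
  have hn1 : (1 : ℝ) ≤ n := by exact_mod_cast hn
  have hn0 : (0 : ℝ) < n := by linarith
  have hl := hpos n hn
  set t := (n : ℝ) ^ (-(1 / 5) : ℝ) with ht
  have ht0 : 0 < t := Real.rpow_pos_of_pos hn0 _
  have ht1 : t ≤ 1 := Real.rpow_le_one_of_one_le_of_nonpos hn1 (by norm_num)
  have ht2 : (n : ℝ) ^ (-(2 / 5) : ℝ) = t ^ 2 := by
    rw [ht, ← Real.rpow_natCast, ← Real.rpow_mul hn0.le]
    norm_num
  have ht5 : (n : ℝ)⁻¹ = t ^ 5 := by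
    rw [ht, ← Real.rpow_natCast, ← Real.rpow_mul hn0.le, ← Real.rpow_neg_one]
    norm_num
  have h1 : lam n ≤ c * t := by
    have := hc ht0.ne'
    rwa [Real.norm_of_nonneg hl.le, Real.norm_of_nonneg ht0.le] at this
  have h2 : t ≤ d * lam n := by
    have := hd hl.ne'
    rwa [Real.norm_of_nonneg hl.le, Real.norm_of_nonneg ht0.le] at this
  have h3 : lam n ^ 2 ≤ c ^ 2 * t ^ 2 := by
    rw [← mul_pow]
    gcongr
  have h4 : (lam n ^ 2)⁻¹ * (n : ℝ)⁻¹ ≤ d ^ 2 * t ^ 2 := by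
    rw [ht5, inv_mul_le_iff₀ (by positivity)]
    -- The variance term is of order `t³`; the spare factor `t ≤ 1` is discarded.
    calc t ^ 5 = t ^ 2 * t ^ 2 * t := by ring
      _ ≤ t ^ 2 * t ^ 2 * 1 := by gcongr
      _ ≤ (d * lam n) ^ 2 * t ^ 2 * 1 := by gcongr
      _ = lam n ^ 2 * (d ^ 2 * t ^ 2) := by ring
  rw [ht2]
  calc _ ≤ a * (c ^ 2 * t ^ 2) + b * (d ^ 2 * t ^ 2) := by gcongr
    _ = _ := by ring

variable {X : Type*} {H : Type*} [NormedAddCommGroup H] [InnerProductSpace ℝ H]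
  [CompleteSpace H] [RKHS ℝ H X ℝ] {k : X → X → ℝ} [MeasurableSpace X]
  {ρ : Measure (X × ℝ)} [IsProbabilityMeasure ρ] {M : ℝ}

/-- A loss of the estimator that is at most `β` plus a multiple of the squared distance to the
regularized regression function has mean at most `β` plus a variance term. -/
theorem integral_krr_loss_le (hk_meas : Measurable (Function.uncurry k))
    (hk : ∀ x y, RKHS.kernel H x y (1 : ℝ) = k x y) (hM : ∀ x y, |k x y| ≤ M)
    (hρ : MemLp (fun z : X × ℝ => z.2) 2 ρ) {f₀ : H} (hf₀ : IsRegressionFunction ρ f₀)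
    {l : ℝ} (hl : 0 < l) {g : H}
    (hg : ∀ h : H, l * inner ℝ g h + inner ℝ (rkhsToLp hk_meas hk hM ρ.fst g)
      (rkhsToLp hk_meas hk hM ρ.fst h) = l * inner ℝ f₀ h) {n : ℕ} (hn : 1 ≤ n)
    {Q : (Fin n → X × ℝ) → ℝ} (hQ : StronglyMeasurable Q) (hQ0 : ∀ z, 0 ≤ Q z) {β γ : ℝ}
    (hγ : 0 ≤ γ) (hQle : ∀ z, Q z ≤ β + γ * ‖krrEstimator H k l z - (f₀ - g)‖ ^ 2)
    {Ω : Type*} [MeasurableSpace Ω] {μ : Measure Ω} [IsProbabilityMeasure μ]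
    {Z : Fin n → Ω → X × ℝ} (hZ : IsIIDSample ρ μ Z) :
    Integrable (fun ω => Q fun i => Z i ω) μ ∧
      ∫ ω, Q (fun i => Z i ω) ∂μ ≤ β + γ * (M * (2 * ∫ z, z.2 ^ 2 ∂ρ + 8 * (M * ‖f₀‖ ^ 2))) *
        ((l ^ 2)⁻¹ * (n : ℝ)⁻¹) := by
  obtain ⟨hi, hle⟩ := integral_norm_sq_krr_residual_le hk_meas hk hM hρ hf₀ hl hg
    (Nat.one_le_iff_ne_zero.1 hn)
  have hi' := (integrable_const (μ := Measure.pi fun _ : Fin n => ρ) β).add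
    (hi.const_mul (γ * (l ^ 2)⁻¹))
  obtain ⟨h1, h2⟩ := hZ.hasLaw_pi.integral_comp_le_of_le hQ hQ0 (fun z => by
    refine (hQle z).trans ?_
    simp only [Pi.add_apply, mul_assoc]
    gcongr
    exact norm_krrEstimator_sub_sq_le hk hl z (f₀ - g)) hi'
  refine ⟨h1, h2.trans ?_⟩
  simp only [Pi.add_apply]
  rw [integral_add (integrable_const _) (hi.const_mul _), integral_const_mul, integral_const,
    probReal_univ, one_smul]
  calc _ ≤ β + γ * (l ^ 2)⁻¹ *
        ((n : ℝ)⁻¹ * (M * (2 * ∫ z, z.2 ^ 2 ∂ρ + 8 * (M * ‖f₀‖ ^ 2)))) := by gcongr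
    _ = _ := by ring

/-- The bias is kept in `L²`, where (ii) controls it; the deviation is bounded pointwise by its
`H`-norm. -/
theorem integral_sub_krrEstimator_sq_le (hk_meas : Measurable (Function.uncurry k))
    (hk : ∀ x y, RKHS.kernel H x y (1 : ℝ) = k x y) (hM : ∀ x y, |k x y| ≤ M)
    (P : Measure X) [IsProbabilityMeasure P] (f₀ g f : H) :
    ∫ x, (f₀ x - f x) ^ 2 ∂P ≤
      2 * ‖rkhsToLp hk_meas hk hM P g‖ ^ 2 + 2 * M * ‖f - (f₀ - g)‖ ^ 2 := by
  have hsq : ∀ h : H, Integrable (fun x => (h x) ^ 2) P := fun h =>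
    (memLp_rkhs hk_meas hk hM P h).integrable_sq
  have hfg : (fun x => (f₀ x - f x) ^ 2) = fun x => ((f₀ - f) x) ^ 2 := by
    funext x
    rw [RKHS.coe_sub, Pi.sub_apply]
  have hbound : ∀ x, ((f₀ - f) x) ^ 2 ≤ 2 * (g x) ^ 2 + 2 * (M * ‖f - (f₀ - g)‖ ^ 2) := by
    intro x
    have h1 := sq_apply_le hk hM (f - (f₀ - g)) x
    have h2 : (f₀ - f) x = g x - (f - (f₀ - g)) x := by
      simp only [RKHS.coe_sub, Pi.sub_apply]
      ring
    rw [h2]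
    nlinarith [sq_nonneg (g x + (f - (f₀ - g)) x)]
  rw [hfg]
  refine (integral_mono (hsq _) (((hsq g).const_mul 2).add (integrable_const _)) hbound).trans_eq ?_
  simp only [Pi.add_apply]
  rw [integral_add ((hsq g).const_mul 2) (integrable_const _), integral_const_mul,
    integral_const, probReal_univ, one_smul,
    ← real_inner_self_eq_norm_sq (rkhsToLp hk_meas hk hM P g), inner_rkhsToLp]
  simp only [pow_two]
  ring

end Risk

/-! ### The two convergence rates -/

theorem mainTheorem3 {X : Type*} [MeasurableSpace X]
    (k : X → X → ℝ) (hk_meas : Measurable (Function.uncurry k))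
    (hk_bdd : ∃ M : ℝ, ∀ x y, |k x y| ≤ M)
    (H : Type*) [NormedAddCommGroup H] [InnerProductSpace ℝ H] [CompleteSpace H]
    [RKHS ℝ H X ℝ] (hk : ∀ x y, RKHS.kernel H x y (1 : ℝ) = k x y)
    (ρ : Measure (X × ℝ)) [IsProbabilityMeasure ρ]
    (hρ : MemLp (fun z : X × ℝ => z.2) 2 ρ)
    (f₀ : H) (hf₀ : IsRegressionFunction ρ f₀) :
    ((∃ w₀ : H, ⇑f₀ = kernelOp k ρ.fst w₀) →
      ∀ C : ℝ, 0 < C → ∃ B : ℝ, ∀ n : ℕ, 1 ≤ n →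
      ∀ (Ω : Type*) [MeasurableSpace Ω] (μ : Measure Ω) [IsProbabilityMeasure μ]
        (Z : Fin n → Ω → X × ℝ), IsIIDSample ρ μ Z →
        Integrable (fun ω => ‖f₀ - krrEstimator H k (C * (n : ℝ) ^ (-(1 / 5) : ℝ))
          (fun i => Z i ω)‖ ^ 2) μ ∧
        ∫ ω, ‖f₀ - krrEstimator H k (C * (n : ℝ) ^ (-(1 / 5) : ℝ)) (fun i => Z i ω)‖ ^ 2 ∂μ
          ≤ B * (n : ℝ) ^ (-(2 / 5) : ℝ)) ∧
    ((∃ w₀ : X → ℝ, MemLp w₀ 2 ρ.fst ∧ ⇑f₀ = kernelOp k ρ.fst w₀) →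
      ∀ lam : ℕ → ℝ, (∀ n, 1 ≤ n → 0 < lam n) →
      lam =Θ[atTop] (fun n : ℕ => (n : ℝ) ^ (-(1 / 5) : ℝ)) →
      ∃ B : ℝ, ∀ n : ℕ, 1 ≤ n →
      ∀ (Ω : Type*) [MeasurableSpace Ω] (μ : Measure Ω) [IsProbabilityMeasure μ]
        (Z : Fin n → Ω → X × ℝ), IsIIDSample ρ μ Z →
        Integrable (fun ω => ∫ x, (f₀ x - krrEstimator H k (lam n) (fun i => Z i ω) x) ^ 2
          ∂ρ.fst) μ ∧
        ∫ ω, (∫ x, (f₀ x - krrEstimator H k (lam n) (fun i => Z i ω) x) ^ 2 ∂ρ.fst) ∂μ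
          ≤ B * (n : ℝ) ^ (-(2 / 5) : ℝ)) := by
  obtain ⟨M, hM⟩ := hk_bdd
  -- A point is needed for `M ≥ 0`: on an empty space any `M` would bound the kernel.
  obtain ⟨z₀⟩ := nonempty_of_isProbabilityMeasure ρ
  have hM0 : 0 ≤ M := (abs_nonneg _).trans (hM z₀.1 z₀.1)
  set V : ℝ := M * (2 * ∫ z, z.2 ^ 2 ∂ρ + 8 * (M * ‖f₀‖ ^ 2)) with hV
  have hV0 : 0 ≤ V := by
    have : 0 ≤ ∫ z : X × ℝ, z.2 ^ 2 ∂ρ := integral_nonneg fun z => sq_nonneg _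
    positivity
  constructor
  · rintro ⟨w₀, hw₀⟩ C hC
    have hpos : ∀ n : ℕ, 1 ≤ n → 0 < C * (n : ℝ) ^ (-(1 / 5) : ℝ) := fun n hn =>
      mul_pos hC (Real.rpow_pos_of_pos (by exact_mod_cast hn) _)
    obtain ⟨B, hB⟩ := exists_rate_bound_of_isTheta hpos
      ((isTheta_refl _ _).const_mul_left hC.ne') (a := 2 * ‖w₀‖ ^ 2) (b := 2 * V) (by positivity)
      (by positivity)
    refine ⟨B, fun n hn Ω _ μ _ Z hZ => ?_⟩
    have hBn := hB n hn
    have hl := hpos n hn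
    set l := C * (n : ℝ) ^ (-(1 / 5) : ℝ)
    obtain ⟨g, hg⟩ := exists_tikhonov_bias (rkhsToLp hk_meas hk hM ρ.fst) hl f₀
    -- The `L²` class of `w₀` is `S w₀` by definition, which yields the stronger source condition.
    have hbias : ‖g‖ ≤ l * ‖w₀‖ := norm_tikhonov_bias_le_of_source hl hg
      (inner_eq_inner_toLp_of_eq_kernelOp hk_meas hk hM ρ.fst
        (memLp_rkhs hk_meas hk hM ρ.fst w₀) hw₀)
    have hQle : ∀ z : Fin n → X × ℝ, ‖f₀ - krrEstimator H k l z‖ ^ 2 ≤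
        2 * ‖w₀‖ ^ 2 * l ^ 2 + 2 * ‖krrEstimator H k l z - (f₀ - g)‖ ^ 2 := by
      intro z
      have h3 : ‖f₀ - krrEstimator H k l z‖ ≤ l * ‖w₀‖ + ‖krrEstimator H k l z - (f₀ - g)‖ := by
        have h4 : f₀ - krrEstimator H k l z = g - (krrEstimator H k l z - (f₀ - g)) := by abel
        rw [h4]
        exact (norm_sub_le _ _).trans (by gcongr)
      calc ‖f₀ - krrEstimator H k l z‖ ^ 2
          ≤ (l * ‖w₀‖ + ‖krrEstimator H k l z - (f₀ - g)‖) ^ 2 := by gcongr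
        _ ≤ 2 * ((l * ‖w₀‖) ^ 2 + ‖krrEstimator H k l z - (f₀ - g)‖ ^ 2) := add_sq_le
        _ = _ := by ring
    obtain ⟨h1, h2⟩ := integral_krr_loss_le hk_meas hk hM hρ hf₀ hl hg hn
      (Q := fun z => ‖f₀ - krrEstimator H k l z‖ ^ 2) (β := 2 * ‖w₀‖ ^ 2 * l ^ 2) (γ := 2)
      (measurable_norm_sub_krrEstimator_sq hk_meas hk f₀ l n).stronglyMeasurable
      (fun z => sq_nonneg _) zero_le_two hQle hZ
    exact ⟨h1, h2.trans hBn⟩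
  · rintro ⟨w₀, hw₀, hfw₀⟩ lam hpos hlam
    obtain ⟨B, hB⟩ := exists_rate_bound_of_isTheta hpos hlam (a := 2 * ‖hw₀.toLp w₀‖ ^ 2)
      (b := 2 * M * V) (by positivity) (by positivity)
    refine ⟨B, fun n hn Ω _ μ _ Z hZ => ?_⟩
    have hl := hpos n hn
    obtain ⟨g, hg⟩ := exists_tikhonov_bias (rkhsToLp hk_meas hk hM ρ.fst) hl f₀
    have hbias : ‖rkhsToLp hk_meas hk hM ρ.fst g‖ ≤ lam n * ‖hw₀.toLp w₀‖ :=
      norm_map_tikhonov_bias_le hl hg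
        (inner_eq_inner_toLp_of_eq_kernelOp hk_meas hk hM ρ.fst hw₀ hfw₀)
    have hQle : ∀ z : Fin n → X × ℝ, ∫ x, (f₀ x - krrEstimator H k (lam n) z x) ^ 2 ∂ρ.fst ≤
        2 * ‖hw₀.toLp w₀‖ ^ 2 * lam n ^ 2 +
          2 * M * ‖krrEstimator H k (lam n) z - (f₀ - g)‖ ^ 2 := by
      intro z
      refine (integral_sub_krrEstimator_sq_le hk_meas hk hM ρ.fst f₀ g _).trans ?_
      gcongr ?_ + _
      calc 2 * ‖rkhsToLp hk_meas hk hM ρ.fst g‖ ^ 2 ≤ 2 * (lam n * ‖hw₀.toLp w₀‖) ^ 2 := by gcongr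
        _ = _ := by ring
    obtain ⟨h1, h2⟩ := integral_krr_loss_le hk_meas hk hM hρ hf₀ hl hg hn
      (Q := fun z => ∫ x, (f₀ x - krrEstimator H k (lam n) z x) ^ 2 ∂ρ.fst)
      (β := 2 * ‖hw₀.toLp w₀‖ ^ 2 * lam n ^ 2) (γ := 2 * M)
      (stronglyMeasurable_integral_sub_krrEstimator_sq hk_meas hk f₀ (lam n) n ρ.fst)
      (fun z => integral_nonneg fun x => sq_nonneg _) (by positivity) hQle hZ
    exact ⟨h1, h2.trans (hB n hn)⟩
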